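/- Let $\mathfrak g$ be a real Lie algebra of dimension $4$, let $g$ be an inner product on $\mathfrak g$, and let $J:\mathfrak g\to\mathfrak g$ be a linear map with $J^2=-\mathrm{Id}$ and $g(Jx,Jy)=g(x,y)$ for all $x,y\in\mathfrak g$. Put $\omega(x,y)=g(Jx,y)$. Let $\nabla$ be the Levi-Civita connection of the corresponding left-invariant metric, i.e. the bilinear map $\nabla:\mathfrak g\times\mathfrak g\to\mathfrak g$ determined by $$2g(\nabla_xy,z)=g([x,y],z)-g([y,z],x)+g([z,x],y)\qquad(x,y,z\in\mathfrak g),$$ and let $R_{xyzw}=g(\nabla_x\nabla_yz-\nabla_y\nabla_xz-\nabla_{[x,y]}z,\,w)$ be its curvature tensor. Assume that $J$ is integrable, that is, $$[Jx,Jy]-[x,y]-J[Jx,y]-J[x,Jy]=0\qquad\text{for all }x,y\in\mathfrak g,$$ and that Gray's first condition holds: $$R_{xyzw}=R_{xy\,Jz\,Jw}\qquad\text{for all }x,y,z,w\in\mathfrak g.$$ Then $(g,J,\omega)$ is a Kähler structure; that is, $J$ is integrable and $d\omega=0$, where $d\omega(x,y,z)=-\omega([x,y],z)-\omega([y,z],x)-\omega([z,x],y)$.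 -/

import Mathlib

/-- An almost Hermitian structure on a real Lie algebra `𝔤`: an inner product `g` and a
`g`-orthogonal complex structure `J` on the vector space `𝔤`. It is the value at the identity of a
left-invariant almost Hermitian structure on a Lie group with Lie algebra `𝔤`. -/
structure AlmostHermitianLieAlgebra (𝔤 : Type*) [LieRing 𝔤] [LieAlgebra ℝ 𝔤] where
  /-- the inner product -/
  g : LinearMap.BilinForm ℝ 𝔤
  symm : ∀ x y : 𝔤, g x y = g y x
  pos : ∀ x : 𝔤, x ≠ 0 → 0 < g x x
  /-- the almost complex structure -/
  J : 𝔤 →ₗ[ℝ] 𝔤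
  J_sq : ∀ x : 𝔤, J (J x) = -x
  J_orthogonal : ∀ x y : 𝔤, g (J x) (J y) = g x y

namespace AlmostHermitianLieAlgebra

variable {𝔤 : Type*} [LieRing 𝔤] [LieAlgebra ℝ 𝔤] (S : AlmostHermitianLieAlgebra 𝔤)

/-- The fundamental 2-form `ω(x, y) = g(J x, y)`. -/
def omega (x y : 𝔤) : ℝ := S.g (S.J x) y

/-- The exterior derivative of the left-invariant 2-form `ω`:
`dω(x, y, z) = - ω([x, y], z) - ω([y, z], x) - ω([z, x], y)`. The terms of the invariant formula
for `d` that differentiate functions vanish, `ω` being constant on left-invariant fields. -/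
def dOmega (x y z : 𝔤) : ℝ := -S.omega ⁅x, y⁆ z - S.omega ⁅y, z⁆ x - S.omega ⁅z, x⁆ y

/-- The Nijenhuis tensor of `J`. -/
def nijenhuis (x y : 𝔤) : 𝔤 := ⁅S.J x, S.J y⁆ - ⁅x, y⁆ - S.J ⁅S.J x, y⁆ - S.J ⁅x, S.J y⁆

/-- `J` is integrable, that is, the structure is Hermitian. -/
def IsHermitian : Prop := ∀ x y : 𝔤, S.nijenhuis x y = 0

/-- The structure is Kähler: `J` is integrable and the fundamental form is closed. -/
def IsKahler : Prop := S.IsHermitian ∧ ∀ x y z : 𝔤, S.dOmega x y z = 0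

theorem g_nondegenerate : S.g.Nondegenerate := by
  refine ⟨fun x hx => ?_, fun x hx => ?_⟩
  · by_contra h
    exact (S.pos x h).ne' (hx x)
  · by_contra h
    exact (S.pos x h).ne' (hx x)

/-- The right-hand side of the Koszul formula for left-invariant fields, as a functional of `z`:
`(g([x, y], z) - g([y, z], x) + g([z, x], y)) / 2`. -/
noncomputable def koszul (x y : 𝔤) : Module.Dual ℝ 𝔤 where
  toFun z := (S.g ⁅x, y⁆ z - S.g ⁅y, z⁆ x + S.g ⁅z, x⁆ y) / 2
  map_add' z w := by
    simp only [lie_add, add_lie, map_add, LinearMap.add_apply]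
    ring
  map_smul' t z := by
    simp only [lie_smul, smul_lie, map_smul, LinearMap.smul_apply, smul_eq_mul, RingHom.id_apply]
    ring

variable [FiniteDimensional ℝ 𝔤]

/-- The Levi-Civita connection `∇_x y` of the left-invariant metric `g` on left-invariant fields:
the vector that represents the Koszul functional with respect to `g`. -/
noncomputable def nabla (x y : 𝔤) : 𝔤 := (S.g.toDual S.g_nondegenerate).symm (S.koszul x y)

theorem g_nabla (x y z : 𝔤) :
    S.g (S.nabla x y) z = (S.g ⁅x, y⁆ z - S.g ⁅y, z⁆ x + S.g ⁅z, x⁆ y) / 2 :=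
  LinearMap.BilinForm.apply_toDual_symm_apply (hB := S.g_nondegenerate) (S.koszul x y) z

/-- The connection is metric. -/
theorem nabla_metric (x y z : 𝔤) : S.g (S.nabla x y) z + S.g y (S.nabla x z) = 0 := by
  rw [S.symm y, g_nabla, g_nabla, ← lie_skew x y, ← lie_skew x z, ← lie_skew z y]
  simp only [map_neg, LinearMap.neg_apply]
  ring

/-- The connection is torsion-free. -/
theorem nabla_torsion_free (x y : 𝔤) : S.nabla x y - S.nabla y x = ⁅x, y⁆ := by
  refine sub_eq_zero.1 (S.g_nondegenerate.1 _ fun z => ?_)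
  simp only [map_sub, LinearMap.sub_apply, g_nabla]
  rw [← lie_skew x y, ← lie_skew x z, ← lie_skew z y]
  simp only [map_neg, LinearMap.neg_apply]
  ring

/-- The Riemannian curvature tensor `R_{xyzw} = g(∇_x ∇_y z - ∇_y ∇_x z - ∇_{[x, y]} z, w)`. -/
noncomputable def curvature (x y z w : 𝔤) : ℝ :=
  S.g (S.nabla x (S.nabla y z) - S.nabla y (S.nabla x z) - S.nabla ⁅x, y⁆ z) w

/-- Gray's first curvature condition, `R_{xyzw} = R_{xy Jz Jw}`. -/
def GrayFirst : Prop :=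
  ∀ x y z w : 𝔤, S.curvature x y z w = S.curvature x y (S.J z) (S.J w)

end AlmostHermitianLieAlgebra

/-! A 3-form in dimension four has a kernel vector (`exists_mem_ker_dOmega`), so a unitary frame can
be chosen with `e 1` in the kernel of dω; only t = dω(e 0, e 2, e 3) can survive. Integrability
makes ∇J linear in dω, hence t times a constant tensor in this frame. Gray's condition says that
R(x, y) commutes with J, and [R(x, y), J] is the antisymmetrised second derivative of J; so each of
its components is t times a linear form in t and the structure constants. If t ≠ 0, these linear
forms vanish and fix most structure constants. Two Jacobi identities then make a sum of squares
containing t² vanish, a contradiction (`eq_zero_of_adapted_structure_constants`). -/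

/-- The Christoffel symbols of a left-invariant metric in an orthonormal frame with structure
constants `c`. -/
noncomputable def christoffel (c : Fin 4 → Fin 4 → Fin 4 → ℝ) (i j k : Fin 4) : ℝ :=
  (c i j k - c j k i + c k i j) / 2

/-- The curvature of a left-invariant metric in an orthonormal frame with structure constants `c`. -/
noncomputable def curvatureCoeff (c : Fin 4 → Fin 4 → Fin 4 → ℝ) (i j k l : Fin 4) : ℝ :=
  ∑ m, (christoffel c i k m * christoffel c j l m - christoffel c j k m * christoffel c i l m
    - c i j m * christoffel c m k l)

set_option maxHeartbeats 1000000 in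
/-- Structure constants of a Hermitian Lie algebra in a unitary frame, adapted so that `e 1` lies
in the kernel of `dω`. If the curvature commutes with `J`, then the only other component
`t = dω(e 0, e 2, e 3)` vanishes. -/
theorem eq_zero_of_adapted_structure_constants (c : Fin 4 → Fin 4 → Fin 4 → ℝ)
    (hc : ∀ i j k, c i j k = -c j i k)
    (hN0 : c 1 3 0 = c 0 2 0 - c 1 2 1 - c 0 3 1)
    (hN1 : c 1 2 0 = c 1 3 1 - c 0 2 1 - c 0 3 0)
    (hN2 : c 1 3 2 = c 0 2 2 - c 1 2 3 - c 0 3 3)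
    (hN3 : c 1 3 3 = c 0 2 3 + c 1 2 2 + c 0 3 2)
    (hd2 : c 1 2 1 = -c 0 1 3 - c 0 2 0)
    (hd3 : c 1 3 1 = c 0 1 2 - c 0 3 0)
    (hd1 : c 2 3 0 = -c 1 2 2 - c 1 3 3) (t : ℝ)
    (ht : c 2 3 1 = t + c 0 2 2 + c 0 3 3)
    (hR1 : ∀ i j, curvatureCoeff c i j 0 2 = curvatureCoeff c i j 1 3)
    (hR2 : ∀ i j, curvatureCoeff c i j 0 3 = -curvatureCoeff c i j 1 2)
    (hJ : ∀ i j k l, ∑ m, (c i j m * c m k l + c j k m * c m i l + c k i m * c m j l) = 0) :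
    t = 0 := by
  by_contra h0
  have z : ∀ i k, c i i k = 0 := fun i k => by linarith [hc i i k]
  have e10 := hc 1 0
  have e20 := hc 2 0
  have e30 := hc 3 0
  have e21 := hc 2 1
  have e31 := hc 3 1
  have e32 := hc 3 2
  have p01 := sub_eq_zero.2 (hR1 0 1)
  have p02 := sub_eq_zero.2 (hR1 0 2)
  have p13 := sub_eq_zero.2 (hR1 1 3)
  have p12 := sub_eq_zero.2 (hR1 1 2)
  have p23 := sub_eq_zero.2 (hR1 2 3)
  have q01 := sub_eq_zero.2 (hR2 0 1)
  have q03 := sub_eq_zero.2 (hR2 0 3)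
  have q13 := sub_eq_zero.2 (hR2 1 3)
  have q23 := sub_eq_zero.2 (hR2 2 3)
  have j1 := hJ 0 2 3 1
  have j0 := hJ 1 2 3 0
  clear hR1 hR2 hc hJ
  simp only [curvatureCoeff, christoffel, Fin.sum_univ_four, e10, e20, e30, e21, e31, e32, z, hN0,
    hN1, hN2, hN3, hd2, hd3, hd1, ht] at p01 p02 p12 p13 p23 q01 q03 q13 q23 j0 j1
  -- After the linear substitutions every curvature equation has a factor t, which is cancelled here
  -- and below.
  have c012 : c 0 1 2 = 0 := mul_left_cancel₀ h0 (by linear_combination (-2) * p01)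
  have c013 : c 0 1 3 = 0 := mul_left_cancel₀ h0 (by linear_combination (-2) * q01)
  have c022 : c 0 2 2 = 0 := mul_left_cancel₀ h0 (by linear_combination (-2) * p02)
  have c033 : c 0 3 3 = 0 := mul_left_cancel₀ h0 (by linear_combination (-2) * q03)
  have c122 : c 1 2 2 = 0 := mul_left_cancel₀ h0 (by linear_combination (-2) * p12)
  have c032 : c 0 3 2 = -c 0 2 3 :=
    mul_left_cancel₀ h0 (by linear_combination (-2) * q13 + 2 * p12)
  have c011 : c 0 1 1 = -t / 2 := mul_left_cancel₀ h0 (by linear_combination 2 * p13 + 2 * q03)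
  have c021 : c 0 2 1 = -c 0 3 0 := mul_left_cancel₀ h0 (by linear_combination 2 * p23)
  have c031 : c 0 3 1 = c 0 2 0 := mul_left_cancel₀ h0 (by linear_combination 2 * q23)
  clear p01 p02 p12 p13 p23 q01 q03 q13 q23
  simp only [c012, c013, c022, c033, c122, c032, c011, c021, c031] at j0 j1
  -- The `e 1` component of Jacobi on (e 0, e 2, e 3) minus the `e 0` component of Jacobi on (e 1, e
  -- 2, e 3).
  have : t ^ 2 + 8 * c 0 2 0 ^ 2 + 8 * c 0 3 0 ^ 2 = 0 := by linear_combination 2 * (j1 - j0)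
  have : 0 < t ^ 2 := by positivity
  linarith [sq_nonneg (c 0 2 0), sq_nonneg (c 0 3 0)]

/-- A totally antisymmetric array in dimension four is determined by its four components with
increasing indices. -/
theorem alternating_eq_zero (D : Fin 4 → Fin 4 → Fin 4 → ℝ) (hs : ∀ i j k, D i j k = -D j i k)
    (hr : ∀ i j k, D i j k = D j k i) (h1 : D 0 1 2 = 0) (h2 : D 0 1 3 = 0) (h3 : D 0 2 3 = 0)
    (h4 : D 1 2 3 = 0) (i j k : Fin 4) : D i j k = 0 := by
  fin_cases i <;> fin_cases j <;> fin_cases k <;> dsimp <;> grind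

namespace AlmostHermitianLieAlgebra

variable {𝔤 : Type*} [LieRing 𝔤] [LieAlgebra ℝ 𝔤] (S : AlmostHermitianLieAlgebra 𝔤)

theorem dOmega_add_left (x x' y z : 𝔤) :
    S.dOmega (x + x') y z = S.dOmega x y z + S.dOmega x' y z := by
  simp only [dOmega, omega, add_lie, lie_add, map_add, LinearMap.add_apply]
  ring

theorem dOmega_smul_left (r : ℝ) (x y z : 𝔤) : S.dOmega (r • x) y z = r * S.dOmega x y z := by
  simp only [dOmega, omega, smul_lie, lie_smul, map_smul, LinearMap.smul_apply, smul_eq_mul]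
  ring

theorem dOmega_rotate (x y z : 𝔤) : S.dOmega x y z = S.dOmega y z x := by
  simp only [dOmega]
  ring

theorem dOmega_swap (x y z : 𝔤) : S.dOmega x y z = -S.dOmega y x z := by
  simp only [dOmega, omega]
  rw [← lie_skew x y, ← lie_skew x z, ← lie_skew z y]
  simp only [map_neg, LinearMap.neg_apply]
  ring

theorem g_J_left (x y : 𝔤) : S.g (S.J x) y = -S.g x (S.J y) := by
  rw [← S.J_orthogonal x (S.J y), S.J_sq, map_neg, neg_neg]

theorem g_J_self (x : 𝔤) : S.g x (S.J x) = 0 := by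
  have := S.g_J_left x x
  rw [S.symm] at this
  linarith

/-! ### Unitary frames and components in them -/

/-- An orthonormal frame of the form `e 0, J e 0, e 2, J e 2`. -/
structure IsUnitaryFrame (e : Fin 4 → 𝔤) : Prop where
  orthonormal : ∀ i j, S.g (e i) (e j) = if i = j then 1 else 0
  J_zero : S.J (e 0) = e 1
  J_two : S.J (e 2) = e 3

variable {S}

theorem exists_unit_smul {x : 𝔤} (hx : x ≠ 0) :
    ∃ (r : ℝ) (e : 𝔤), r • e = x ∧ S.g e e = 1 := by
  have hp := S.pos x hx
  have hs : √(S.g x x) ≠ 0 := (Real.sqrt_pos.2 hp).ne'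
  refine ⟨√(S.g x x), (√(S.g x x))⁻¹ • x, smul_inv_smul₀ hs x, ?_⟩
  simp only [map_smul, LinearMap.smul_apply, smul_eq_mul]
  field_simp
  exact (Real.sq_sqrt hp.le).symm

theorem exists_unitaryFrame [FiniteDimensional ℝ 𝔤] (hdim : Module.finrank ℝ 𝔤 = 4) {u : 𝔤}
    (hu : u ≠ 0) : ∃ e : Fin 4 → 𝔤, S.IsUnitaryFrame e ∧ ∃ r : ℝ, r • e 0 = u := by
  obtain ⟨r, a, hr, ha⟩ := exists_unit_smul (S := S) hu
  -- Two linear conditions in dimension four leave a nonzero w orthogonal to a and J a; J w is then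
  -- orthogonal to both as well.
  obtain ⟨w, hw, hw0⟩ := (Submodule.ne_bot_iff _).1 <|
    LinearMap.ker_ne_bot_of_finrank_lt (f := (S.g a).prod (S.g (S.J a))) (by simp [hdim])
  obtain ⟨s, b, hs, hb⟩ := exists_unit_smul (S := S) hw0
  have hs0 : s ≠ 0 := by
    rintro rfl
    exact hw0 (by rw [← hs, zero_smul])
  rw [LinearMap.mem_ker, ← hs] at hw
  have hab : S.g a b = 0 := by simpa [hs0] using congrArg Prod.fst hw
  have hJab : S.g (S.J a) b = 0 := by simpa [hs0] using congrArg Prod.snd hw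
  have haJb : S.g a (S.J b) = 0 := by linarith [S.g_J_left a b]
  have hba : S.g b a = 0 := by rw [S.symm, hab]
  have hbJa : S.g b (S.J a) = 0 := by rw [S.symm, hJab]
  have hJba : S.g (S.J b) a = 0 := by rw [S.symm, haJb]
  refine ⟨![a, S.J a, b, S.J b], ⟨fun i j => ?_, rfl, rfl⟩, r, hr⟩
  fin_cases i <;> fin_cases j <;>
    simp [ha, hb, hab, hba, hJab, hbJa, haJb, hJba, S.J_orthogonal, g_J_self, g_J_left]

namespace IsUnitaryFrame

variable {e : Fin 4 → 𝔤}

theorem J_one (he : S.IsUnitaryFrame e) : S.J (e 1) = -e 0 := by rw [← he.J_zero, S.J_sq]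

theorem J_three (he : S.IsUnitaryFrame e) : S.J (e 3) = -e 2 := by rw [← he.J_two, S.J_sq]

theorem sum_smul (he : S.IsUnitaryFrame e) (hdim : Module.finrank ℝ 𝔤 = 4) (x : 𝔤) :
    x = ∑ k, S.g x (e k) • e k := by
  have hli : LinearIndependent ℝ e := by
    refine Fintype.linearIndependent_iff.2 fun a ha i => ?_
    have := congrArg (fun v => S.g v (e i)) ha
    simpa [map_sum, LinearMap.sum_apply, he.orthonormal] using this
  let b := basisOfLinearIndependentOfCardEqFinrank hli (by simp [hdim])
  have hb : ∀ i, b i = e i := fun i => by simp [b]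
  have hx : x = ∑ i, b.repr x i • e i := by
    conv_lhs => rw [← b.sum_repr x]
    simp only [hb]
  have hg : ∀ k, S.g x (e k) = b.repr x k := fun k => by
    conv_lhs => rw [hx]
    simp [map_sum, LinearMap.sum_apply, he.orthonormal]
  simp only [hg]
  exact hx

theorem g_eq_sum (he : S.IsUnitaryFrame e) (hdim : Module.finrank ℝ 𝔤 = 4) (x y : 𝔤) :
    S.g x y = ∑ k, S.g x (e k) * S.g y (e k) := by
  conv_lhs => rw [he.sum_smul hdim x]
  simp [map_sum, LinearMap.sum_apply, S.symm (e _) y]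

theorem dOmega_eq_zero_of_left (he : S.IsUnitaryFrame e) (hdim : Module.finrank ℝ 𝔤 = 4)
    {y z : 𝔤} (h : ∀ k, S.dOmega (e k) y z = 0) (x : 𝔤) : S.dOmega x y z = 0 := by
  rw [he.sum_smul hdim x]
  simp only [Fin.sum_univ_four, dOmega_add_left, dOmega_smul_left, h, mul_zero, add_zero]

theorem dOmega_eq_zero (he : S.IsUnitaryFrame e) (hdim : Module.finrank ℝ 𝔤 = 4)
    (h1 : S.dOmega (e 0) (e 1) (e 2) = 0) (h2 : S.dOmega (e 0) (e 1) (e 3) = 0)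
    (h3 : S.dOmega (e 0) (e 2) (e 3) = 0) (h4 : S.dOmega (e 1) (e 2) (e 3) = 0) (x y z : 𝔤) :
    S.dOmega x y z = 0 := by
  have h := alternating_eq_zero (fun i j k => S.dOmega (e i) (e j) (e k))
    (fun i j k => S.dOmega_swap _ _ _) (fun i j k => S.dOmega_rotate _ _ _) h1 h2 h3 h4
  refine he.dOmega_eq_zero_of_left hdim (fun i => ?_) x
  rw [dOmega_rotate]
  refine he.dOmega_eq_zero_of_left hdim (fun j => ?_) y
  rw [dOmega_rotate]
  refine he.dOmega_eq_zero_of_left hdim (fun k => ?_) z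
  exact h k i j

theorem jacobi (he : S.IsUnitaryFrame e) (hdim : Module.finrank ℝ 𝔤 = 4) (i j k l : Fin 4) :
    ∑ m, (S.g ⁅e i, e j⁆ (e m) * S.g ⁅e m, e k⁆ (e l) + S.g ⁅e j, e k⁆ (e m) * S.g ⁅e m, e i⁆ (e l)
      + S.g ⁅e k, e i⁆ (e m) * S.g ⁅e m, e j⁆ (e l)) = 0 := by
  have h : ∀ a b c : 𝔤, ∑ m, S.g ⁅a, b⁆ (e m) * S.g ⁅e m, c⁆ (e l) = S.g ⁅⁅a, b⁆, c⁆ (e l) :=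
    fun a b c => by
      conv_rhs => rw [he.sum_smul hdim ⁅a, b⁆]
      simp only [Fin.sum_univ_four, add_lie, smul_lie, map_add, map_smul, LinearMap.add_apply,
        LinearMap.smul_apply, smul_eq_mul]
  have hj := congrArg (fun v => S.g v (e l)) (lie_jacobi (e k) (e i) (e j))
  simp only [map_add, LinearMap.add_apply, map_zero, LinearMap.zero_apply] at hj
  simp only [Finset.sum_add_distrib, h]
  rw [← lie_skew (e k) ⁅e i, e j⁆, ← lie_skew (e i) ⁅e j, e k⁆, ← lie_skew (e j) ⁅e k, e i⁆] at hj
  simp only [map_neg, LinearMap.neg_apply] at hj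
  linarith

variable [FiniteDimensional ℝ 𝔤]

/-- The curvature in a unitary frame, in terms of the structure constants. -/
theorem curvature_eq (he : S.IsUnitaryFrame e) (hdim : Module.finrank ℝ 𝔤 = 4) (i j k l : Fin 4) :
    S.curvature (e i) (e j) (e k) (e l)
      = curvatureCoeff (fun i j k => S.g ⁅e i, e j⁆ (e k)) i j k l := by
  have hn : ∀ i j k, S.g (S.nabla (e i) (e j)) (e k)
      = christoffel (fun i j k => S.g ⁅e i, e j⁆ (e k)) i j k := fun i j k => S.g_nabla _ _ _
  have h2 : ∀ i j k l, S.g (S.nabla (e i) (S.nabla (e j) (e k))) (e l)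
      = -∑ m, christoffel (fun i j k => S.g ⁅e i, e j⁆ (e k)) j k m
        * christoffel (fun i j k => S.g ⁅e i, e j⁆ (e k)) i l m := fun i j k l => by
    -- Metric compatibility moves the outer derivative onto `e l`, leaving an inner product of two
    -- first derivatives.
    rw [eq_neg_of_add_eq_zero_left (S.nabla_metric _ _ _), he.g_eq_sum hdim]
    simp only [hn]
  have h3 : S.g (S.nabla ⁅e i, e j⁆ (e k)) (e l) = ∑ m, S.g ⁅e i, e j⁆ (e m)
      * christoffel (fun i j k => S.g ⁅e i, e j⁆ (e k)) m k l := by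
    simp only [← hn, g_nabla]
    conv_lhs => rw [he.sum_smul hdim ⁅e i, e j⁆]
    simp only [Fin.sum_univ_four, add_lie, lie_add, smul_lie, lie_smul, map_add, map_smul,
      LinearMap.add_apply, LinearMap.smul_apply, smul_eq_mul]
    ring
  simp only [curvature, map_sub, LinearMap.sub_apply, h2, h3, curvatureCoeff,
    Finset.sum_sub_distrib]
  ring

end IsUnitaryFrame

variable [FiniteDimensional ℝ 𝔤]

/-! ### The kernel of dω and the conclusion -/

/-- A 3-form in dimension four has a nonzero vector in its kernel. -/
theorem exists_mem_ker_dOmega (hdim : Module.finrank ℝ 𝔤 = 4) :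
    ∃ u : 𝔤, u ≠ 0 ∧ ∀ y z, S.dOmega u y z = 0 := by
  have : Nontrivial 𝔤 := Module.nontrivial_of_finrank_pos (R := ℝ) (by omega)
  obtain ⟨u, hu⟩ := exists_ne (0 : 𝔤)
  obtain ⟨e, he, -⟩ := exists_unitaryFrame (S := S) hdim hu
  set D : Fin 4 → Fin 4 → Fin 4 → ℝ := fun i j k => S.dOmega (e i) (e j) (e k) with hD
  have hs : ∀ i j k, D i j k = -D j i k := fun i j k => S.dOmega_swap _ _ _
  have hr : ∀ i j k, D i j k = D j k i := fun i j k => S.dOmega_rotate _ _ _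
  -- This is the v with dω = ι_v vol, so ι_v dω = 0. If v = 0 then dω = 0 and any vector serves.
  set v := D 1 2 3 • e 0 + (-D 0 2 3) • e 1 + D 0 1 3 • e 2 + (-D 0 1 2) • e 3 with hv
  by_cases hv0 : v = 0
  · have hg : ∀ k, S.g v (e k) = 0 := fun k => by rw [hv0, map_zero, LinearMap.zero_apply]
    have h0 := hg 0
    have h1 := hg 1
    have h2 := hg 2
    have h3 := hg 3
    simp [hv, he.orthonormal] at h0 h1 h2 h3
    exact ⟨u, hu, he.dOmega_eq_zero hdim h3 h2 h1 h0 u⟩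
  · refine ⟨v, hv0, fun y z => ?_⟩
    rw [dOmega_rotate]
    refine he.dOmega_eq_zero_of_left hdim (fun i => ?_) y
    rw [dOmega_rotate]
    refine he.dOmega_eq_zero_of_left hdim (fun j => ?_) z
    rw [dOmega_rotate]
    simp only [hv, dOmega_add_left, dOmega_smul_left]
    change D 1 2 3 * D 0 i j + -D 0 2 3 * D 1 i j + D 0 1 3 * D 2 i j + -D 0 1 2 * D 3 i j = 0
    clear_value D
    fin_cases i <;> fin_cases j <;> dsimp <;> grind

end AlmostHermitianLieAlgebra

theorem proposition5p8 {𝔤 : Type*} [LieRing 𝔤] [LieAlgebra ℝ 𝔤] [FiniteDimensional ℝ 𝔤]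
    (hdim : Module.finrank ℝ 𝔤 = 4) (S : AlmostHermitianLieAlgebra 𝔤)
    (hherm : S.IsHermitian) (hG : S.GrayFirst) : S.IsKahler := by
  refine ⟨hherm, ?_⟩
  obtain ⟨u, hu, hker⟩ := S.exists_mem_ker_dOmega hdim
  have hJu : S.J u ≠ 0 := fun h => hu (by rw [← neg_eq_zero, ← S.J_sq, h, map_zero])
  -- Starting the frame at J u makes e 1 = J (e 0) a multiple of u, since J² = -1.
  obtain ⟨e, he, r, hr⟩ := AlmostHermitianLieAlgebra.exists_unitaryFrame (S := S) hdim hJu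
  have hr0 : r ≠ 0 := by
    rintro rfl
    exact hJu (by rw [← hr, zero_smul])
  have hker1 : ∀ y z, S.dOmega (e 1) y z = 0 := fun y z => by
    have h := hker y z
    have hu1 : u = (-r) • e 1 := by
      rw [← neg_neg u, ← S.J_sq u, ← hr, map_smul, he.J_zero, neg_smul]
    rw [hu1, S.dOmega_smul_left] at h
    simpa [hr0] using h
  have d2 : S.dOmega (e 0) (e 1) (e 2) = 0 := by rw [S.dOmega_rotate, hker1]
  have d3 : S.dOmega (e 0) (e 1) (e 3) = 0 := by rw [S.dOmega_rotate, hker1]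
  have d1 := hker1 (e 2) (e 3)
  refine he.dOmega_eq_zero hdim d2 d3 ?_ d1
  have hc : ∀ i j k, S.g ⁅e i, e j⁆ (e k) = -S.g ⁅e j, e i⁆ (e k) := fun i j k => by
    rw [← lie_skew, map_neg, LinearMap.neg_apply]
  have hJJ : ∀ x k, S.g (S.J x) (e k) = -S.g x (S.J (e k)) := fun x k => S.g_J_left _ _
  -- As N is antisymmetric and N(Jx, y) = -J N(x, y), this pair carries all of the Nijenhuis tensor.
  have hN : ∀ k, S.g (S.nijenhuis (e 0) (e 2)) (e k) = 0 := fun k => by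
    rw [hherm, map_zero, LinearMap.zero_apply]
  have hN0 := hN 0
  have hN1 := hN 1
  have hN2 := hN 2
  have hN3 := hN 3
  have hR1 : ∀ i j, S.curvature (e i) (e j) (e 0) (e 2) = S.curvature (e i) (e j) (e 1) (e 3) :=
    fun i j => by rw [hG, he.J_zero, he.J_two]
  have hR2 : ∀ i j, S.curvature (e i) (e j) (e 0) (e 3) = -S.curvature (e i) (e j) (e 1) (e 2) :=
    fun i j => by
      rw [hG, he.J_zero, he.J_three]
      simp only [AlmostHermitianLieAlgebra.curvature, map_neg]
  simp only [he.curvature_eq hdim] at hR1 hR2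
  simp only [AlmostHermitianLieAlgebra.nijenhuis, map_sub, LinearMap.sub_apply, hJJ, he.J_zero,
    he.J_one, he.J_two, he.J_three, map_neg] at hN0 hN1 hN2 hN3
  simp only [AlmostHermitianLieAlgebra.dOmega, AlmostHermitianLieAlgebra.omega, hJJ, he.J_zero,
    he.J_one, he.J_two, he.J_three, map_neg] at d1 d2 d3 ⊢
  have h20 := hc 2 0
  have h30 := hc 3 0
  have h31 := hc 3 1
  refine eq_zero_of_adapted_structure_constants (fun i j k => S.g ⁅e i, e j⁆ (e k)) hc ?_ ?_ ?_ ?_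
    ?_ ?_ ?_ _ ?_ hR1 hR2 (he.jacobi hdim) <;>
    linarith [h20 0, h20 1, h20 2, h20 3, h30 0, h30 1, h30 2, h30 3, h31 0, h31 1, h31 2, h31 3]
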